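/- Let $N$ be a non-negative integer and let $A, B \in \mathbb{C}^{N\times N}$ be anti-Hermitian matrices, i.e. $A^\dagger = -A$ and $B^\dagger = -B$. Let $\mathcal{L}(\{A,B\})$ denote the real Lie algebra generated by $A$ and $B$, i.e. the smallest real linear subspace of $\mathbb{C}^{N\times N}$ that contains $A$ and $B$ and is closed under the commutator $[X,Y] = XY - YX$, and let $\|X\|_F = \sqrt{\operatorname{tr}(X^\dagger X)}$ be the Frobenius norm. Then there exists an anti-Hermitian matrix $C \in \mathbb{C}^{N\times N}$ such that $$e^{C} = e^{A}e^{B}, \qquad C \in \mathcal{L}(\{A,B\}), \qquad \|C\|_F \le \|A\|_F + \|B\|_F .$$ -/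

import Mathlib

open scoped Matrix

-- The norm `‖X‖` of a complex matrix is the Frobenius norm.
attribute [local instance] Matrix.frobeniusNormedAddCommGroup

-- The Lie bracket of matrices is the commutator `X * Y - Y * X`.
attribute [local instance 100] LieRing.ofAssociativeRing

open NormedSpace Filter Topology Set

/-! ### The differential of the exponential in a Banach algebra. -/

section BanachAlgebra

variable {𝔸 : Type*} [NormedRing 𝔸] [NormedAlgebra ℝ 𝔸] [CompleteSpace 𝔸]

/-! The proof is a discrete geodesic argument carried out inside the Lie algebra S. Cut `exp A * exp
B` into many short factors `exp (X i)` with `X i` in S, and give factor i a weight `w i`, the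
weights having total ℓ = ‖A‖ + ‖B‖. Among tuples in S with the same product, minimize the energy ∑
‖X i‖² / w i (`exists_energy_minimizer`). Energy at most ℓ forces ‖X i‖² ≤ ℓ * w i, so all factors
of a minimizer stay where the differential of `exp` is invertible. If two neighbouring velocities X
i / w i differ, transferring a factor exp (tW) from one neighbour to the other, W being the
difference of velocities, lowers the energy (`exists_lower_energy_pair`); the first variation is
computed by the Gauss lemma `trace_mul_expDifferential`. Hence X i = w i • Y for all i, the product
collapses to exp (ℓ • Y), and the energy ℓ‖Y‖² ≤ ℓ gives ‖Y‖ ≤ 1. -/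

theorem continuous_exp_real : Continuous (exp : 𝔸 → 𝔸) :=
  let := NormedAlgebra.restrictScalars ℚ ℝ 𝔸
  exp_continuous

theorem exp_add_real {x y : 𝔸} (h : Commute x y) : exp (x + y) = exp x * exp y :=
  let := NormedAlgebra.restrictScalars ℚ ℝ 𝔸
  exp_add_of_commute h

theorem exp_mul_exp_neg (x : 𝔸) : exp x * exp (-x) = 1 := by
  rw [← exp_add_real (Commute.refl x).neg_right, add_neg_cancel, exp_zero]

theorem exp_neg_mul_exp (x : 𝔸) : exp (-x) * exp x = 1 := by
  simpa using exp_mul_exp_neg (-x)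

theorem exp_smul_mul_exp_smul (s t : ℝ) (x : 𝔸) :
    exp (s • x) * exp (t • x) = exp ((s + t) • x) := by
  rw [add_smul, exp_add_real (((Commute.refl x).smul_left s).smul_right t)]

theorem contDiff_exp_real : ContDiff ℝ 2 (exp : 𝔸 → 𝔸) := by
  rw [contDiff_iff_contDiffAt]
  exact fun x => (exp_analytic (𝕂 := ℝ) x).contDiffAt

/-- Duhamel's formula for the difference of two exponentials. -/
theorem exp_sub_exp_eq_integral (a b : 𝔸) :
    exp b - exp a = ∫ s in (0 : ℝ)..1, exp (s • a) * (b - a) * exp ((1 - s) • b) := by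
  have hd : ∀ s : ℝ, HasDerivAt (fun s : ℝ => -(exp (s • a) * exp ((1 - s) • b)))
      (exp (s • a) * (b - a) * exp ((1 - s) • b)) s := by
    intro s
    have h1 := hasDerivAt_exp_smul_const a s
    have h2 : HasDerivAt (fun s : ℝ => exp ((1 - s) • b)) (-(b * exp ((1 - s) • b))) s := by
      have := (hasDerivAt_exp_smul_const' b (1 - s)).scomp s ((hasDerivAt_id s).const_sub 1)
      simpa [Function.comp_def] using this
    refine (h1.mul h2).neg.congr_deriv ?_
    noncomm_ring
  have hc : Continuous fun s : ℝ => exp (s • a) * (b - a) * exp ((1 - s) • b) := by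
    have := continuous_exp_real (𝔸 := 𝔸)
    fun_prop
  rw [intervalIntegral.integral_eq_sub_of_hasDerivAt (fun s _ => hd s)
    (hc.intervalIntegrable _ _)]
  simp [neg_add_eq_sub]

/-- The derivative of the exponential along a differentiable curve. -/
theorem hasDerivAt_exp_comp {Z : ℝ → 𝔸} {V : 𝔸} {t : ℝ} (hZ : HasDerivAt Z V t) :
    HasDerivAt (fun u => exp (Z u))
      (∫ s in (0 : ℝ)..1, exp (s • Z t) * V * exp ((1 - s) • Z t)) t := by
  -- By Duhamel's formula the slope of `exp ∘ Z` is this integral at (Z u, slope of Z), so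
  -- continuity in the pair gives the limit.
  have hG : Continuous fun p : 𝔸 × 𝔸 => ∫ s in (0 : ℝ)..1,
      exp (s • Z t) * p.2 * exp ((1 - s) • p.1) := by
    have := continuous_exp_real (𝔸 := 𝔸)
    apply intervalIntegral.continuous_parametric_intervalIntegral_of_continuous'
    fun_prop
  rw [hasDerivAt_iff_tendsto_slope]
  have h1 : Tendsto (fun u => (Z u, slope Z t u)) (𝓝[≠] t) (𝓝 (Z t, V)) :=
    (hZ.continuousAt.tendsto.mono_left nhdsWithin_le_nhds).prodMk_nhds hZ.tendsto_slope
  refine ((hG.tendsto (Z t, V)).comp h1).congr fun u => ?_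
  simp only [Function.comp, slope_def_module]
  rw [exp_sub_exp_eq_integral, ← intervalIntegral.integral_smul]
  simp

theorem fderiv_exp_eq_integral (X V : 𝔸) :
    fderiv ℝ exp X V = ∫ s in (0 : ℝ)..1, exp (s • X) * V * exp ((1 - s) • X) := by
  have hl : HasDerivAt (fun t : ℝ => X + t • V) V 0 := by
    simpa using ((hasDerivAt_id (0 : ℝ)).smul_const V).const_add X
  have h1 := hasDerivAt_exp_comp hl
  have hd : HasFDerivAt exp (fderiv ℝ exp X) (X + (0 : ℝ) • V) := by
    simpa using (contDiff_exp_real.differentiable (by norm_num) X).hasFDerivAt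
  have h2 := hd.comp_hasDerivAt (0 : ℝ) hl
  simpa using h2.unique h1

/-- The differential of the exponential, left-translated to the identity. -/
noncomputable def expDifferential (X : 𝔸) : 𝔸 →L[ℝ] 𝔸 :=
  (ContinuousLinearMap.mul ℝ 𝔸 (exp (-X))).comp (fderiv ℝ exp X)

omit [CompleteSpace 𝔸] in
theorem expDifferential_apply (X V : 𝔸) :
    expDifferential X V = exp (-X) * fderiv ℝ exp X V := rfl

theorem expDifferential_eq_integral (X V : 𝔸) :
    expDifferential X V =
      ∫ s in (0 : ℝ)..1, exp ((s - 1) • X) * V * exp ((1 - s) • X) := by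
  have hc : Continuous fun s : ℝ => exp (s • X) * V * exp ((1 - s) • X) := by
    have := continuous_exp_real (𝔸 := 𝔸)
    fun_prop
  rw [expDifferential_apply, fderiv_exp_eq_integral]
  have := (ContinuousLinearMap.mul ℝ 𝔸 (exp (-X))).intervalIntegral_comp_comm
    (hc.intervalIntegrable (μ := MeasureTheory.volume) 0 1)
  rw [ContinuousLinearMap.mul_apply'] at this
  rw [← this]
  congr 1 with s
  rw [ContinuousLinearMap.mul_apply', ← mul_assoc, ← mul_assoc, ← neg_one_smul ℝ X,
    exp_smul_mul_exp_smul]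
  ring_nf

theorem expDifferential_zero : expDifferential (0 : 𝔸) = 1 := by
  ext V
  simp [expDifferential_eq_integral]

theorem contDiff_expDifferential : ContDiff ℝ 1 (expDifferential : 𝔸 → 𝔸 →L[ℝ] 𝔸) := by
  have h1 : ContDiff ℝ 1 (fderiv ℝ (exp : 𝔸 → 𝔸)) :=
    contDiff_exp_real.fderiv_right (by norm_num)
  have h2 : ContDiff ℝ 1 fun X : 𝔸 => ContinuousLinearMap.mul ℝ 𝔸 (exp (-X)) :=
    (ContinuousLinearMap.mul ℝ 𝔸).contDiff.comp
      ((contDiff_exp_real.of_le (by norm_num)).comp contDiff_neg)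
  exact h2.clm_comp h1

/-- A continuous trace pairs `X` with a tangent vector and with its left-translated image under
the differential of the exponential at `X` in the same way. -/
theorem trace_mul_expDifferential (τ : 𝔸 →L[ℝ] ℝ) (hτ : ∀ x y, τ (x * y) = τ (y * x))
    (X V : 𝔸) : τ (X * expDifferential X V) = τ (X * V) := by
  have hc : Continuous fun s : ℝ => exp ((s - 1) • X) * V * exp ((1 - s) • X) := by
    have := continuous_exp_real (𝔸 := 𝔸)
    fun_prop
  rw [expDifferential_eq_integral]
  have := (τ.comp (ContinuousLinearMap.mul ℝ 𝔸 X)).intervalIntegral_comp_comm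
    (hc.intervalIntegrable (μ := MeasureTheory.volume) 0 1)
  simp only [ContinuousLinearMap.comp_apply, ContinuousLinearMap.mul_apply'] at this
  rw [← this]
  -- Cyclicity brings the two exponentials together; they commute with X and cancel.
  have key : ∀ s : ℝ, τ (X * (exp ((s - 1) • X) * V * exp ((1 - s) • X))) = τ (X * V) := by
    intro s
    have hX : Commute (exp ((1 - s) • X)) X := ((Commute.refl X).smul_left _).exp_left
    rw [← mul_assoc, hτ, ← mul_assoc, ← mul_assoc, hX.eq, mul_assoc X, exp_smul_mul_exp_smul]
    simp
  simp [key]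

/-- Conjugation by exponentials of elements preserves a closed subspace stable under
commutators. -/
theorem exp_neg_mul_mul_exp_mem {S : Submodule ℝ 𝔸} (hcl : IsClosed (S : Set 𝔸))
    (hS : ∀ x ∈ S, ∀ y ∈ S, x * y - y * x ∈ S) {X V : 𝔸} (hX : X ∈ S) (hV : V ∈ S) :
    exp (-X) * V * exp X ∈ S := by
  let D : 𝔸 →L[ℝ] 𝔸 := (ContinuousLinearMap.mul ℝ 𝔸).flip X - ContinuousLinearMap.mul ℝ 𝔸 X
  have hD : ∀ y, D y = y * X - X * y := fun y => rfl
  have hpow : ∀ n : ℕ, (D ^ n) V ∈ S := by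
    intro n
    induction n with
    | zero => simpa
    | succ n ih =>
      rw [pow_succ', mul_apply_eq_comp, hD]
      exact hS _ ih _ hX
  have hmem : exp D V ∈ S := by
    have h := (exp_series_hasSum_exp' (𝕂 := ℝ) D).mapL (ContinuousLinearMap.apply ℝ 𝔸 V)
    exact hcl.mem_of_tendsto h (Eventually.of_forall fun s =>
      S.sum_mem fun i _ => S.smul_mem _ (hpow i))
  -- Constancy of this curve identifies conjugation by exp X with exp D, whose series applied to V
  -- has partial sums in S.
  have hder : ∀ t : ℝ, HasDerivAt
      (fun t : ℝ => exp (t • X) * exp (t • D) V * exp (t • (-X))) 0 t := by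
    intro t
    have h1 := hasDerivAt_exp_smul_const X t
    have h2 : HasDerivAt (fun t : ℝ => exp (t • D) V) (D (exp (t • D) V)) t :=
      (ContinuousLinearMap.apply ℝ 𝔸 V).hasFDerivAt.comp_hasDerivAt t
        (hasDerivAt_exp_smul_const' D t)
    have h3 := hasDerivAt_exp_smul_const' (-X) t
    refine ((h1.mul h2).mul h3).congr_deriv ?_
    simp only [hD, Pi.mul_apply]
    noncomm_ring
  have hconst := is_const_of_deriv_eq_zero (fun t => (hder t).differentiableAt)
    (fun t => (hder t).deriv) 1 0
  have h0 : (0 : ℝ) • D = 0 := zero_smul ℝ D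
  have h1 : (1 : ℝ) • D = D := one_smul ℝ D
  simp only [h0, h1, one_smul, zero_smul, exp_zero, one_mul, mul_one,
    one_apply_eq_self] at hconst
  have : exp (-X) * V * exp X = exp D V := by
    nth_rw 1 [← hconst]
    rw [← mul_assoc, ← mul_assoc, exp_neg_mul_exp, one_mul, mul_assoc, exp_neg_mul_exp, mul_one]
  rwa [this]

/-- The integrand consists of conjugates lying in S; a continuous projection onto S fixes them and
commutes with the integral. -/
theorem expDifferential_mem {S : Submodule ℝ 𝔸} (hcl : IsClosed (S : Set 𝔸))
    (hcompl : S.ClosedComplemented)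
    (hS : ∀ x ∈ S, ∀ y ∈ S, x * y - y * x ∈ S) {X V : 𝔸} (hX : X ∈ S) (hV : V ∈ S) :
    expDifferential X V ∈ S := by
  obtain ⟨P, hP⟩ := hcompl
  have hc : Continuous fun s : ℝ => exp ((s - 1) • X) * V * exp ((1 - s) • X) := by
    have := continuous_exp_real (𝔸 := 𝔸)
    fun_prop
  have := (S.subtypeL.comp P).intervalIntegral_comp_comm (hc.intervalIntegrable (μ := MeasureTheory.volume) 0 1)
  have hint : ∀ s : ℝ, (S.subtypeL.comp P) (exp ((s - 1) • X) * V * exp ((1 - s) • X)) =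
      exp ((s - 1) • X) * V * exp ((1 - s) • X) := by
    intro s
    have hm : exp ((s - 1) • X) * V * exp ((1 - s) • X) ∈ S := by
      rw [show (s - 1) • X = -((1 - s) • X) by rw [← neg_smul, neg_sub]]
      exact exp_neg_mul_mul_exp_mem hcl hS (S.smul_mem _ hX) hV
    simpa using congrArg Subtype.val (hP ⟨_, hm⟩)
  simp only [hint] at this
  rw [expDifferential_eq_integral, this]
  exact (P _).2

end BanachAlgebra

/-! ### Lifting curves through the exponential, and the first variation of the energy. -/

section FiniteDimensional

variable {𝔸 : Type*} [NormedRing 𝔸] [NormedAlgebra ℝ 𝔸] [CompleteSpace 𝔸] [FiniteDimensional ℝ 𝔸]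

omit [FiniteDimensional ℝ 𝔸] in
theorem exists_pos_forall_isUnit_expDifferential :
    ∃ ε > 0, ∀ X : 𝔸, ‖X‖ < ε → IsUnit (expDifferential X) := by
  have h : ∀ᶠ X : 𝔸 in 𝓝 0, IsUnit (expDifferential X) := by
    refine (contDiff_expDifferential.continuous.tendsto (0 : 𝔸)).eventually
      ((Units.isOpen (R := 𝔸 →L[ℝ] 𝔸)).mem_nhds ?_)
    change IsUnit _
    rw [expDifferential_zero]
    exact isUnit_one
  obtain ⟨ε, hε, hb⟩ := Metric.eventually_nhds_iff.1 h
  exact ⟨ε, hε, fun X hX => hb (by simpa using hX)⟩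

/-- The differential restricts to an injective endomorphism of the finite-dimensional S, which is
therefore surjective. -/
theorem inverse_expDifferential_mem {S : Submodule ℝ 𝔸}
    (hS : ∀ x ∈ S, ∀ y ∈ S, x * y - y * x ∈ S) {X W : 𝔸} (hX : X ∈ S) (hW : W ∈ S)
    (hu : IsUnit (expDifferential X)) : Ring.inverse (expDifferential X) W ∈ S := by
  have hinv : ∀ v, Ring.inverse (expDifferential X) (expDifferential X v) = v := fun v => by
    rw [← mul_apply_eq_comp, Ring.inverse_mul_cancel _ hu, one_apply_eq_self]
  let T : S →ₗ[ℝ] S := (expDifferential X).toLinearMap.restrict fun V hV =>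
    expDifferential_mem S.closed_of_finiteDimensional (.of_finiteDimensional S) hS hX hV
  have hT : ∀ v : S, (T v : 𝔸) = expDifferential X v := fun v => rfl
  have hinj : Function.Injective T := fun v w h => by
    have h1 := congrArg (fun u : S => Ring.inverse (expDifferential X) (u : 𝔸)) h
    simp only [hT, hinv] at h1
    exact Subtype.ext h1
  obtain ⟨V, hV⟩ := (LinearMap.injective_iff_surjective.1 hinj) ⟨W, hW⟩
  have : expDifferential X (V : 𝔸) = W := by rw [← hT, hV]
  rw [← this, hinv]
  exact V.2

/-- Right translates `exp X * exp (t • W)` lift, for small `t`, to a curve of logarithms in a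
given commutator-stable subspace. -/
theorem exists_exp_lift {S : Submodule ℝ 𝔸}
    (hS : ∀ x ∈ S, ∀ y ∈ S, x * y - y * x ∈ S) {X W : 𝔸} (hX : X ∈ S) (hW : W ∈ S)
    (hu : IsUnit (expDifferential X)) :
    ∃ (Z : ℝ → 𝔸) (V : 𝔸), Z 0 = X ∧ HasDerivAt Z V 0 ∧ expDifferential X V = W ∧
      ∀ᶠ t in 𝓝 (0 : ℝ), Z t ∈ S ∧ exp (Z t) = exp X * exp (t • W) := by
  obtain ⟨P, hP⟩ := Submodule.ClosedComplemented.of_finiteDimensional S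
  -- The lift solves the ODE z' = f z in S. The projection P makes f take values in S everywhere and
  -- changes nothing where the differential is invertible.
  let f : S → S := fun x => P (Ring.inverse (expDifferential (x : 𝔸)) W)
  have hf : ContDiffAt ℝ 1 f ⟨X, hX⟩ := by
    obtain ⟨u, hu⟩ := hu
    have h1 : ContDiffAt ℝ 1 (fun x : S => expDifferential (x : 𝔸)) ⟨X, hX⟩ :=
      (contDiff_expDifferential.comp S.subtypeL.contDiff).contDiffAt
    have h2 : ContDiffAt ℝ 1 (Ring.inverse : (𝔸 →L[ℝ] 𝔸) → _) (expDifferential X) := by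
      rw [← hu]
      exact contDiffAt_ringInverse ℝ u
    have h3 : ContDiffAt ℝ 1 (fun x : S => Ring.inverse (expDifferential (x : 𝔸))) ⟨X, hX⟩ :=
      ContDiffAt.comp (g := Ring.inverse) (f := fun x : S => expDifferential (x : 𝔸))
        (⟨X, hX⟩ : S) h2 h1
    exact P.contDiff.contDiffAt.comp _ (h3.clm_apply contDiffAt_const)
  obtain ⟨z, hz0, ε, hε, hz⟩ :=
    hf.exists_forall_mem_closedBall_exists_eq_forall_mem_Ioo_hasDerivAt₀ 0
  simp only [zero_sub, zero_add] at hz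
  have h0 : (0 : ℝ) ∈ Ioo (-ε) ε := ⟨by linarith, hε⟩
  have hfT : ∀ x : S, IsUnit (expDifferential (x : 𝔸)) →
      expDifferential (x : 𝔸) (f x : 𝔸) = W := by
    intro x hx
    have h1 : (f x : 𝔸) = Ring.inverse (expDifferential (x : 𝔸)) W :=
      congrArg Subtype.val (hP ⟨_, inverse_expDifferential_mem hS x.2 hW hx⟩)
    rw [h1, ← mul_apply_eq_comp, Ring.mul_inverse_cancel _ hx, one_apply_eq_self]
  have hZ : ∀ t ∈ Ioo (-ε) ε, HasDerivAt (fun t => (z t : 𝔸)) (f (z t) : 𝔸) t := fun t ht =>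
    S.subtypeL.hasFDerivAt.comp_hasDerivAt t (hz t ht)
  refine ⟨fun t => z t, f (z 0), by simp [hz0], hZ 0 h0, ?_, ?_⟩
  · rw [hz0]
    exact hfT ⟨X, hX⟩ hu
  have hunit : ∀ᶠ t in 𝓝 (0 : ℝ), IsUnit (expDifferential (z t : 𝔸)) := by
    refine ((contDiff_expDifferential.continuous.tendsto (z 0 : 𝔸)).comp
      (hZ 0 h0).continuousAt.tendsto).eventually
      ((Units.isOpen (R := 𝔸 →L[ℝ] 𝔸)).mem_nhds ?_)
    change IsUnit _
    simpa [hz0] using hu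
  obtain ⟨δ, hδ, hball⟩ := Metric.eventually_nhds_iff_ball.1
    (hunit.and (Ioo_mem_nhds h0.1 h0.2))
  have hder : ∀ t ∈ Metric.ball (0 : ℝ) δ,
      HasDerivAt (fun t => exp (z t : 𝔸) * exp (t • (-W))) 0 t := by
    intro t ht
    obtain ⟨hut, htε⟩ := hball t ht
    have h1 : HasDerivAt (fun t => exp (z t : 𝔸)) (exp (z t : 𝔸) * W) t := by
      have h := (contDiff_exp_real.differentiable (by norm_num)
        (z t : 𝔸)).hasFDerivAt.comp_hasDerivAt t (hZ t htε)
      refine h.congr_deriv ?_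
      rw [← hfT (z t) hut, expDifferential_apply, ← mul_assoc, exp_mul_exp_neg, one_mul]
    refine (h1.mul (hasDerivAt_exp_smul_const' (-W) t)).congr_deriv ?_
    noncomm_ring
  filter_upwards [Metric.ball_mem_nhds (0 : ℝ) hδ] with t ht
  refine ⟨(z t).2, ?_⟩
  have hc := Metric.isOpen_ball.is_const_of_deriv_eq_zero
    (convex_ball (0 : ℝ) δ).isPreconnected
    (fun t ht => (hder t ht).differentiableAt.differentiableWithinAt)
    (fun t ht => (hder t ht).deriv) ht (Metric.mem_ball_self hδ)
  simp only [zero_smul, exp_zero, mul_one, hz0] at hc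
  rw [← hc, mul_assoc, smul_neg, exp_neg_mul_exp, mul_one]

/-- If two small logarithms have different speeds relative to positive weights, the weighted
energy of the pair can be lowered without changing the product of the exponentials. -/
theorem exists_lower_energy_pair {S : Submodule ℝ 𝔸}
    (hS : ∀ x ∈ S, ∀ y ∈ S, x * y - y * x ∈ S) (τ : 𝔸 →L[ℝ] ℝ)
    (hτ : ∀ x y, τ (x * y) = τ (y * x)) (hn : ∀ x ∈ S, ‖x‖ ^ 2 = -τ (x * x))
    {X Y : 𝔸} (hX : X ∈ S) (hY : Y ∈ S) (huX : IsUnit (expDifferential X))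
    (huY : IsUnit (expDifferential (-Y))) {a b : ℝ} (hab : a⁻¹ • X ≠ b⁻¹ • Y) :
    ∃ X' ∈ S, ∃ Y' ∈ S, exp X' * exp Y' = exp X * exp Y ∧
      ‖X'‖ ^ 2 / a + ‖Y'‖ ^ 2 / b < ‖X‖ ^ 2 / a + ‖Y‖ ^ 2 / b := by
  by_contra! hmin
  set W := b⁻¹ • Y - a⁻¹ • X with hWdef
  have hW : W ∈ S := S.sub_mem (S.smul_mem _ hY) (S.smul_mem _ hX)
  obtain ⟨Z₁, V₁, h10, h1d, h1T, h1e⟩ := exists_exp_lift hS hX hW huX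
  -- Lifting from -Y turns left multiplication into right: exp (-Z₂ t) = exp (-tW) * exp Y, so the
  -- two factors exp (±tW) cancel in the product.
  obtain ⟨Z₂, V₂, h20, h2d, h2T, h2e⟩ := exists_exp_lift hS (S.neg_mem hY) hW huY
  let E : ℝ → ℝ := fun t => -τ (Z₁ t * Z₁ t) / a + -τ (Z₂ t * Z₂ t) / b
  have hloc : IsLocalMin E 0 := by
    filter_upwards [h1e, h2e] with t ht1 ht2
    have hprod : exp (Z₁ t) * exp (-Z₂ t) = exp X * exp Y := by
      have h : exp (-Z₂ t) = exp (-(t • W)) * exp Y := by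
        have h1 : exp (Z₂ t) * (exp (-(t • W)) * exp Y) = 1 := by
          rw [ht2.2, mul_assoc, ← mul_assoc (exp (t • W)), exp_mul_exp_neg, one_mul,
            exp_neg_mul_exp]
        calc exp (-Z₂ t) = exp (-Z₂ t) * (exp (Z₂ t) * (exp (-(t • W)) * exp Y)) := by
              rw [h1, mul_one]
          _ = _ := by rw [← mul_assoc, exp_neg_mul_exp, one_mul]
      rw [h, ht1.2, mul_assoc, ← mul_assoc (exp (t • W)), exp_mul_exp_neg, one_mul]
    have := hmin _ ht1.1 _ (S.neg_mem ht2.1) hprod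
    simp only [E, h10, h20]
    rwa [norm_neg, hn _ hX, hn _ hY, hn _ ht1.1, hn _ ht2.1, ← neg_mul_neg Y Y] at this
  have hsq : ∀ {Z : ℝ → 𝔸} {V : 𝔸}, HasDerivAt Z V 0 →
      HasDerivAt (fun t => -τ (Z t * Z t)) (-(2 * τ (Z 0 * V))) 0 := by
    intro Z V h
    refine (τ.hasFDerivAt.comp_hasDerivAt (0 : ℝ) (h.mul h)).neg.congr_deriv ?_
    rw [map_add, hτ V]
    ring
  -- By the Gauss lemma this derivative equals 2τ(W * W) = -2‖W‖², so minimality forces W = 0.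
  have hd := hloc.hasDerivAt_eq_zero (((hsq h1d).div_const a).add ((hsq h2d).div_const b))
  rw [h10, h20, ← trace_mul_expDifferential τ hτ X, ← trace_mul_expDifferential τ hτ (-Y),
    h1T, h2T] at hd
  have h2 : ‖W‖ ^ 2 = 0 := by
    rw [hn W hW]
    nth_rw 1 [hWdef]
    rw [sub_mul, smul_mul_assoc, smul_mul_assoc, map_sub, map_smul, map_smul, smul_eq_mul,
      smul_eq_mul]
    rw [neg_mul, map_neg] at hd
    linear_combination -hd / 2
  have h3 : W = 0 := by simpa using h2
  exact hab (sub_eq_zero.1 h3).symm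

end FiniteDimensional

/-! ### Ordered products of exponentials and their energy. -/

section ExpProd

variable {𝔸 : Type*} [NormedRing 𝔸] [NormedAlgebra ℝ 𝔸] [CompleteSpace 𝔸]

/-- The ordered product `exp (X 0) * exp (X 1) * ⋯ * exp (X (n - 1))`. -/
noncomputable def expProd (X : ℕ → 𝔸) : ℕ → 𝔸
  | 0 => 1
  | n + 1 => expProd X n * exp (X n)

omit [NormedAlgebra ℝ 𝔸] [CompleteSpace 𝔸] in
theorem expProd_congr {X Y : ℕ → 𝔸} {n : ℕ} (h : ∀ i < n, X i = Y i) :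
    expProd X n = expProd Y n := by
  induction n with
  | zero => rfl
  | succ n ih => rw [expProd, expProd, ih fun i hi => h i (by omega), h n (by omega)]

theorem continuous_expProd (n : ℕ) : Continuous fun X : ℕ → 𝔸 => expProd X n := by
  induction n with
  | zero => exact continuous_const
  | succ n ih => exact ih.mul (continuous_exp_real.comp (continuous_apply n))

/-- The tuple `X` with its entries `i` and `i + 1` replaced. -/
def updatePair (X : ℕ → 𝔸) (i : ℕ) (x y : 𝔸) : ℕ → 𝔸 :=
  Function.update (Function.update X i x) (i + 1) y

omit [NormedAlgebra ℝ 𝔸] [CompleteSpace 𝔸] in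
theorem expProd_updatePair {X : ℕ → 𝔸} {i n : ℕ} {x y : 𝔸} (hi : i + 1 < n)
    (h : exp x * exp y = exp (X i) * exp (X (i + 1))) :
    expProd (updatePair X i x y) n = expProd X n := by
  induction n, hi using Nat.le_induction with
  | base =>
    have h1 : expProd (updatePair X i x y) i = expProd X i := expProd_congr fun j hj => by
      rw [updatePair, Function.update_of_ne (by omega), Function.update_of_ne (by omega)]
    simp only [expProd, h1]
    simp [updatePair, mul_assoc, h]
  | succ n hn ih =>
    rw [expProd, ih, expProd, updatePair, Function.update_of_ne (by omega),
      Function.update_of_ne (by omega)]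

theorem expProd_smul_const {X : ℕ → 𝔸} {w : ℕ → ℝ} {Y : 𝔸} {n : ℕ}
    (h : ∀ i < n, X i = w i • Y) :
    expProd X n = exp ((∑ i ∈ Finset.range n, w i) • Y) := by
  induction n with
  | zero => simp [expProd]
  | succ n ih =>
    rw [expProd, ih fun i hi => h i (by omega), h n (by omega), exp_smul_mul_exp_smul,
      Finset.sum_range_succ]

/-- The energy of a tuple with respect to weights. -/
noncomputable def weightedEnergy (w : ℕ → ℝ) (n : ℕ) (X : ℕ → 𝔸) : ℝ :=
  ∑ i ∈ Finset.range n, ‖X i‖ ^ 2 / w i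

omit [NormedAlgebra ℝ 𝔸] [CompleteSpace 𝔸] in
theorem continuous_weightedEnergy (w : ℕ → ℝ) (n : ℕ) :
    Continuous (weightedEnergy w n : (ℕ → 𝔸) → ℝ) := by
  unfold weightedEnergy
  fun_prop

omit [NormedAlgebra ℝ 𝔸] [CompleteSpace 𝔸] in
theorem norm_sq_le_of_weightedEnergy_le {w : ℕ → ℝ} {n : ℕ} {X : ℕ → 𝔸} {ℓ : ℝ}
    (hw : ∀ i < n, 0 < w i) (h : weightedEnergy w n X ≤ ℓ) {i : ℕ} (hi : i < n) :
    ‖X i‖ ^ 2 ≤ ℓ * w i := by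
  rw [← div_le_iff₀ (hw i hi)]
  refine le_trans ?_ h
  exact Finset.single_le_sum (f := fun i => ‖X i‖ ^ 2 / w i)
    (fun j hj => div_nonneg (sq_nonneg _) (hw j (Finset.mem_range.1 hj)).le)
    (Finset.mem_range.2 hi)

omit [NormedAlgebra ℝ 𝔸] [CompleteSpace 𝔸] in
theorem weightedEnergy_updatePair_lt {w : ℕ → ℝ} {n : ℕ} {X : ℕ → 𝔸} {i : ℕ} {x y : 𝔸}
    (hi : i + 1 < n)
    (h : ‖x‖ ^ 2 / w i + ‖y‖ ^ 2 / w (i + 1) < ‖X i‖ ^ 2 / w i + ‖X (i + 1)‖ ^ 2 / w (i + 1)) :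
    weightedEnergy w n (updatePair X i x y) < weightedEnergy w n X := by
  induction n, hi using Nat.le_induction with
  | base =>
    have h1 : weightedEnergy w i (updatePair X i x y) = weightedEnergy w i X :=
      Finset.sum_congr rfl fun j hj => by
        have := Finset.mem_range.1 hj
        rw [updatePair, Function.update_of_ne (by omega), Function.update_of_ne (by omega)]
    unfold weightedEnergy at h1 ⊢
    simp only [Nat.succ_eq_add_one, Finset.sum_range_succ, h1]
    simp only [updatePair, Function.update_self, ne_eq, Nat.left_eq_add, one_ne_zero,
      not_false_eq_true, Function.update_of_ne]
    linarith
  | succ n hn ih =>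
    unfold weightedEnergy at ih ⊢
    rw [Finset.sum_range_succ, Finset.sum_range_succ]
    have : updatePair X i x y n = X n := by
      rw [updatePair, Function.update_of_ne (by omega), Function.update_of_ne (by omega)]
    rw [this]
    linarith

end ExpProd

/-! ### Existence of minimizers and their shape. -/

section Minimization

variable {𝔸 : Type*} [NormedRing 𝔸] [NormedAlgebra ℝ 𝔸] [CompleteSpace 𝔸] [FiniteDimensional ℝ 𝔸]

theorem exists_energy_minimizer {S : Submodule ℝ 𝔸} {w : ℕ → ℝ} {n : ℕ}
    (hw : ∀ i < n, 0 < w i) {X₀ : ℕ → 𝔸} (hX₀ : ∀ i, X₀ i ∈ S) :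
    ∃ X : ℕ → 𝔸, (∀ i, X i ∈ S) ∧ expProd X n = expProd X₀ n ∧
      weightedEnergy w n X ≤ weightedEnergy w n X₀ ∧
      ∀ X' : ℕ → 𝔸, (∀ i, X' i ∈ S) → expProd X' n = expProd X₀ n →
        weightedEnergy w n X ≤ weightedEnergy w n X' := by
  have : ProperSpace 𝔸 := FiniteDimensional.proper_real 𝔸
  set ℓ := weightedEnergy w n X₀ with hℓ
  -- Radius 0 beyond n makes the infinite product compact; `trunc` moves competitors into it without
  -- changing energy or product.
  let B : ℕ → Set 𝔸 := fun i => Metric.closedBall 0 (if i < n then √(ℓ * w i) else 0) ∩ S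
  let K : Set (ℕ → 𝔸) := univ.pi B ∩ {X | expProd X n = expProd X₀ n}
  have hK : IsCompact K :=
    (isCompact_univ_pi fun i => (isCompact_closedBall _ _).inter_right
      S.closed_of_finiteDimensional).inter_right
      (isClosed_singleton.preimage (continuous_expProd n))
  let trunc : (ℕ → 𝔸) → ℕ → 𝔸 := fun X i => if i < n then X i else 0
  have htE : ∀ X, weightedEnergy w n (trunc X) = weightedEnergy w n X := fun X =>
    Finset.sum_congr rfl fun i hi => by simp [trunc, Finset.mem_range.1 hi]
  have htK : ∀ X : ℕ → 𝔸, (∀ i, X i ∈ S) → expProd X n = expProd X₀ n →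
      weightedEnergy w n X ≤ ℓ → trunc X ∈ K := by
    intro X hXS hXp hXE
    refine ⟨fun i _ => ?_, ?_⟩
    · by_cases hi : i < n
      · have := Real.le_sqrt_of_sq_le (norm_sq_le_of_weightedEnergy_le hw hXE hi)
        simp [B, trunc, hi, this, hXS i]
      · simp [B, trunc, hi]
    · rw [mem_ofPred_eq, ← hXp]
      exact expProd_congr fun i hi => by simp [trunc, hi]
  obtain ⟨X, hXK, hmin⟩ := hK.exists_isMinOn ⟨_, htK X₀ hX₀ rfl hℓ.ge⟩
    (continuous_weightedEnergy w n).continuousOn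
  have hle : weightedEnergy w n X ≤ ℓ := by
    have := hmin (htK X₀ hX₀ rfl hℓ.ge)
    rwa [mem_ofPred_eq, htE] at this
  refine ⟨X, fun i => (hXK.1 i (mem_univ i)).2, hXK.2, hle, fun X' hS' hp' => ?_⟩
  by_cases h : weightedEnergy w n X' ≤ ℓ
  · have := hmin (htK X' hS' hp' h)
    rwa [mem_ofPred_eq, htE] at this
  · linarith

/-- A product of exponentials subdivided finely enough, with energy at most its total weight, is
a single exponential of norm at most the total weight. -/
theorem exists_exp_eq_expProd {S : Submodule ℝ 𝔸}
    (hS : ∀ x ∈ S, ∀ y ∈ S, x * y - y * x ∈ S) (τ : 𝔸 →L[ℝ] ℝ)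
    (hτ : ∀ x y, τ (x * y) = τ (y * x)) (hn : ∀ x ∈ S, ‖x‖ ^ 2 = -τ (x * x))
    {ε : ℝ} (hε : 0 < ε) (hunit : ∀ X : 𝔸, ‖X‖ < ε → IsUnit (expDifferential X))
    {w : ℕ → ℝ} {n : ℕ} (hpos : 0 < n) (hw : ∀ i < n, 0 < w i)
    {X₀ : ℕ → 𝔸} (hX₀ : ∀ i, X₀ i ∈ S)
    (hE : weightedEnergy w n X₀ ≤ ∑ i ∈ Finset.range n, w i)
    (hsmall : ∀ i < n, (∑ j ∈ Finset.range n, w j) * w i < ε ^ 2) :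
    ∃ C ∈ S, exp C = expProd X₀ n ∧ ‖C‖ ≤ ∑ i ∈ Finset.range n, w i := by
  obtain ⟨X, hXS, hXp, hXE, hmin⟩ := exists_energy_minimizer hw hX₀
  set ℓ := ∑ i ∈ Finset.range n, w i
  have hℓ : 0 < ℓ := Finset.sum_pos (fun i hi => hw i (Finset.mem_range.1 hi))
    ⟨0, Finset.mem_range.2 hpos⟩
  have hXε : ∀ i < n, ‖X i‖ < ε := fun i hi => lt_of_pow_lt_pow_left₀ 2 hε.le
    ((norm_sq_le_of_weightedEnergy_le hw (hXE.trans hE) hi).trans_lt (hsmall i hi))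
  have hstep : ∀ i, i + 1 < n → (w i)⁻¹ • X i = (w (i + 1))⁻¹ • X (i + 1) := by
    intro i hi
    by_contra hne
    obtain ⟨x, hx, y, hy, hxy, hlt⟩ := exists_lower_energy_pair hS τ hτ hn (hXS i) (hXS (i + 1))
      (hunit _ (hXε i (by omega))) (hunit _ (by rw [norm_neg]; exact hXε _ hi)) hne
    refine (weightedEnergy_updatePair_lt hi hlt).not_ge (hmin _ (fun j => ?_)
      ((expProd_updatePair hi hxy).trans hXp))
    by_cases h1 : j = i + 1
    · subst h1
      simpa [updatePair] using hy
    · by_cases h2 : j = i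
      · subst h2
        simpa [updatePair] using hx
      · rw [updatePair, Function.update_of_ne h1, Function.update_of_ne h2]
        exact hXS j
  set Y := (w 0)⁻¹ • X 0 with hY
  have hall : ∀ i, i < n → (w i)⁻¹ • X i = Y := by
    intro i
    induction i with
    | zero => exact fun _ => rfl
    | succ i ih => exact fun hi => (hstep i hi).symm.trans (ih (by omega))
  have hXY : ∀ i < n, X i = w i • Y := fun i hi => by
    rw [← hall i hi, smul_inv_smul₀ (hw i hi).ne']
  refine ⟨ℓ • Y, S.smul_mem _ (S.smul_mem _ (hXS 0)), ?_, ?_⟩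
  · rw [← hXp, expProd_smul_const hXY]
  have hEY : weightedEnergy w n X = ℓ * ‖Y‖ ^ 2 := by
    rw [weightedEnergy, Finset.sum_mul]
    refine Finset.sum_congr rfl fun i hi => ?_
    have := hw i (Finset.mem_range.1 hi)
    rw [hXY i (Finset.mem_range.1 hi), norm_smul, mul_pow, Real.norm_eq_abs, sq_abs]
    field_simp
  have h1 : ‖Y‖ ≤ 1 := by
    have : ℓ * ‖Y‖ ^ 2 ≤ ℓ * 1 := by rw [← hEY, mul_one]; exact hXE.trans hE
    have := le_of_mul_le_mul_left this hℓ
    exact (sq_le_one_iff₀ (norm_nonneg _)).1 this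
  rw [norm_smul, Real.norm_of_nonneg hℓ.le]
  exact mul_le_of_le_one_right hℓ.le h1

/-- In a finite-dimensional algebra, the product of the exponentials of two elements of a
commutator-stable subspace on which the norm comes from a trace form is the exponential of an
element of this subspace whose norm satisfies the triangle inequality. -/
theorem exists_exp_eq_exp_mul_exp {S : Submodule ℝ 𝔸}
    (hS : ∀ x ∈ S, ∀ y ∈ S, x * y - y * x ∈ S) (τ : 𝔸 →L[ℝ] ℝ)
    (hτ : ∀ x y, τ (x * y) = τ (y * x)) (hn : ∀ x ∈ S, ‖x‖ ^ 2 = -τ (x * x))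
    {A B : 𝔸} (hA : A ∈ S) (hB : B ∈ S) :
    ∃ C ∈ S, exp C = exp A * exp B ∧ ‖C‖ ≤ ‖A‖ + ‖B‖ := by
  -- The weights ‖A‖ / m and ‖B‖ / m below must be positive.
  rcases eq_or_ne A 0 with rfl | hA0
  · exact ⟨B, hB, by simp, by simp⟩
  rcases eq_or_ne B 0 with rfl | hB0
  · exact ⟨A, hA, by simp, by simp⟩
  have ha : 0 < ‖A‖ := norm_pos_iff.2 hA0
  have hb : 0 < ‖B‖ := norm_pos_iff.2 hB0
  obtain ⟨ε, hε, hunit⟩ := exists_pos_forall_isUnit_expDifferential (𝔸 := 𝔸)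
  -- Each weight is at most ℓ / m, so this m gives ℓ * w i ≤ ℓ² / m < ε².
  obtain ⟨m, hm⟩ := exists_nat_gt ((‖A‖ + ‖B‖) ^ 2 / ε ^ 2)
  have hm0 : (0 : ℝ) < m := lt_of_le_of_lt (by positivity) hm
  have hm1 : 0 < m := by exact_mod_cast hm0
  rw [div_lt_iff₀ (by positivity)] at hm
  let X₀ : ℕ → 𝔸 := fun i => if i < m then (m : ℝ)⁻¹ • A else (m : ℝ)⁻¹ • B
  let w : ℕ → ℝ := fun i => if i < m then ‖A‖ / m else ‖B‖ / m
  have hw : ∀ i, 0 < w i := fun i => by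
    simp only [w]
    split_ifs <;> positivity
  have hX₀ : ∀ i, X₀ i ∈ S := fun i => by
    simp only [X₀]
    split_ifs
    exacts [S.smul_mem _ hA, S.smul_mem _ hB]
  have hnorm : ∀ i, ‖X₀ i‖ = w i := fun i => by
    simp only [X₀, w]
    split_ifs <;> rw [norm_smul, norm_inv, Real.norm_natCast, div_eq_inv_mul]
  have hsum : ∑ i ∈ Finset.range (m + m), w i = ‖A‖ + ‖B‖ := by
    rw [Finset.sum_range_add]
    have h1 : ∑ i ∈ Finset.range m, w i = ∑ i ∈ Finset.range m, ‖A‖ / m :=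
      Finset.sum_congr rfl fun i hi => by simp [w, Finset.mem_range.1 hi]
    have h2 : ∑ i ∈ Finset.range m, w (m + i) = ∑ i ∈ Finset.range m, ‖B‖ / m :=
      Finset.sum_congr rfl fun i hi => by simp [w]
    rw [h1, h2]
    simp only [Finset.sum_const, Finset.card_range, nsmul_eq_mul]
    field_simp
  have hpowexp : ∀ (V : 𝔸), exp ((m : ℝ)⁻¹ • V) ^ m = exp V := fun V => by
    let := NormedAlgebra.restrictScalars ℚ ℝ 𝔸
    rw [← exp_nsmul, ← Nat.cast_smul_eq_nsmul ℝ, smul_inv_smul₀ hm0.ne']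
  have hprodA : ∀ k ≤ m, expProd X₀ k = exp ((m : ℝ)⁻¹ • A) ^ k := by
    intro k
    induction k with
    | zero => simp [expProd]
    | succ k ih =>
      intro hk
      rw [expProd, ih (by omega), pow_succ]
      simp [X₀, show k < m by omega]
  have hprodB : ∀ k, expProd X₀ (m + k) = exp A * exp ((m : ℝ)⁻¹ • B) ^ k := by
    intro k
    induction k with
    | zero => rw [add_zero, hprodA m le_rfl, hpowexp, pow_zero, mul_one]
    | succ k ih =>
      rw [← add_assoc, expProd, ih, pow_succ, mul_assoc]
      simp [X₀]
  have hE : weightedEnergy w (m + m) X₀ ≤ ∑ i ∈ Finset.range (m + m), w i := by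
    refine Finset.sum_le_sum fun i _ => ?_
    rw [hnorm, sq, mul_div_assoc, div_self (hw i).ne', mul_one]
  obtain ⟨C, hC, hexp, hle⟩ := exists_exp_eq_expProd hS τ hτ hn hε hunit (n := m + m) (by omega)
    (fun i _ => hw i) hX₀ hE (by
      intro i _
      have h1 : w i ≤ (‖A‖ + ‖B‖) / m := by
        simp only [w]
        split_ifs
        · gcongr; linarith
        · gcongr; linarith
      rw [hsum]
      calc (‖A‖ + ‖B‖) * w i ≤ (‖A‖ + ‖B‖) * ((‖A‖ + ‖B‖) / m) := by gcongr
        _ = (‖A‖ + ‖B‖) ^ 2 / m := by ring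
        _ < ε ^ 2 := by rw [div_lt_iff₀ hm0]; linarith)
  exact ⟨C, hC, by rw [hexp, hprodB, hpowexp], hsum ▸ hle⟩

end Minimization

/-! ### Anti-Hermitian matrices and the Frobenius norm. -/

section Matrix

variable {n : Type*} [Fintype n]

theorem frobenius_norm_sq_eq_neg_re_trace {X : Matrix n n ℂ} (hX : Xᴴ = -X) :
    ‖X‖ ^ 2 = -(X * X).trace.re := by
  have h1 : ‖X‖ ^ 2 = ∑ i, ∑ j, ‖X i j‖ ^ 2 := by
    rw [Matrix.frobenius_norm_def, ← Real.sqrt_eq_rpow, Real.sq_sqrt (by positivity)]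
    simp
  have h2 : -(X * X) = X * Xᴴ := by rw [hX, mul_neg]
  have h3 : -(X * X).trace.re = (X * Xᴴ).trace.re := by
    rw [← h2, Matrix.trace_neg, Complex.neg_re]
  rw [h1, h3]
  simp only [Matrix.trace, Matrix.diag_apply, Matrix.mul_apply, Matrix.conjTranspose_apply,
    RCLike.star_def, Complex.mul_conj, Complex.normSq_eq_norm_sq, Complex.re_sum,
    Complex.ofReal_re]

variable [DecidableEq n]

/-- The real Lie algebra of anti-Hermitian matrices. -/
def antiHermitianLieSubalgebra (n : Type*) [Fintype n] [DecidableEq n] :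
    LieSubalgebra ℝ (Matrix n n ℂ) where
  carrier := {X | Xᴴ = -X}
  add_mem' {X Y} hX hY := by
    simp only [mem_ofPred_eq] at *
    rw [Matrix.conjTranspose_add, hX, hY, neg_add]
  zero_mem' := by simp
  smul_mem' c X hX := by
    simp only [mem_ofPred_eq] at *
    rw [Matrix.conjTranspose_smul, hX, star_trivial, smul_neg]
  lie_mem' {X Y} hX hY := by
    change Xᴴ = -X at hX
    change Yᴴ = -Y at hY
    change (⁅X, Y⁆)ᴴ = -⁅X, Y⁆
    rw [Ring.lie_def, Matrix.conjTranspose_sub, Matrix.conjTranspose_mul,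
      Matrix.conjTranspose_mul, hX, hY]
    noncomm_ring

end Matrix

theorem lemma1 {n : Type*} [Fintype n] [DecidableEq n] (A B : Matrix n n ℂ)
    (hA : Aᴴ = -A) (hB : Bᴴ = -B) :
    ∃ C : Matrix n n ℂ, Cᴴ = -C ∧
      NormedSpace.exp C = NormedSpace.exp A * NormedSpace.exp B ∧
      C ∈ LieSubalgebra.lieSpan ℝ (Matrix n n ℂ) {A, B} ∧
      ‖C‖ ≤ ‖A‖ + ‖B‖ := by
  let : NormedRing (Matrix n n ℂ) := Matrix.frobeniusNormedRing
  let : NormedAlgebra ℝ (Matrix n n ℂ) := Matrix.frobeniusNormedAlgebra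
  have : CompleteSpace (Matrix n n ℂ) := FiniteDimensional.complete ℝ _
  let L := LieSubalgebra.lieSpan ℝ (Matrix n n ℂ) {A, B}
  have hanti : ∀ X ∈ L, Xᴴ = -X := by
    have : L ≤ antiHermitianLieSubalgebra n := by
      refine LieSubalgebra.lieSpan_le.2 ?_
      rintro X (rfl | rfl)
      exacts [hA, hB]
    exact fun X hX => this hX
  -- The real part of the trace is cyclic, and -τ(X * X) = ‖X‖² on anti-Hermitian X.
  let τ : Matrix n n ℂ →L[ℝ] ℝ := LinearMap.toContinuousLinearMap
    (Complex.reLm ∘ₗ (Matrix.traceLinearMap n ℝ ℂ))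
  obtain ⟨C, hC, hexp, hle⟩ := exists_exp_eq_exp_mul_exp (S := L.toSubmodule)
    (fun x hx y hy => L.lie_mem hx hy) τ
    (fun x y => congrArg Complex.re (Matrix.trace_mul_comm x y))
    (fun x hx => frobenius_norm_sq_eq_neg_re_trace (hanti x hx))
    (A := A) (B := B) (LieSubalgebra.subset_lieSpan (by simp))
    (LieSubalgebra.subset_lieSpan (by simp))
  exact ⟨C, hanti C hC, hexp, hC, hle⟩
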